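/- Fix a depth $D\ge 1$, layer widths $m_0=s,\,m_1,\dots,m_{D-1},\,m_D=t$ (positive integers), and a continuous activation function $\sigma:\mathbb{R}\to\mathbb{R}$, applied componentwise to vectors. Let $\Theta:=\prod_{j=1}^{D}\bigl(\mathbb{R}^{m_j\times m_{j-1}}\times\mathbb{R}^{m_j}\bigr)$ with its Euclidean topology. For $\theta=\{W_j,b_j\}_{j=1}^D\in\Theta$ and $x\in\mathbb{R}^s$ let $\mathcal{N}(x,\theta):=\mathcal{N}^D(x)\in\mathbb{R}^t$, where $\mathcal{N}^1(x):=W_1x+b_1$ and $\mathcal{N}^{j+1}(x):=W_{j+1}\sigma(\mathcal{N}^j(x))+b_{j+1}$ for $1\le j\le D-1$; let $\mathcal{N}_k(x,\theta)$ be its $k$-th component, $1\le k\le t$. Let $C_0(\Theta)$ be the space of continuous real-valued functions on $\Theta$ vanishing at infinity, with the supremum norm, and let $\mathcal{M}(\Theta)$ be the space of finite signed Radon measures on $\Theta$, with the total variation norm $\|\cdot\|_{\mathrm{TV}}$. Let $\rho:\Theta\to(0,\infty)$ be continuous, and assume that $$\mathcal{N}_k(x,\cdot)\rho(\cdot)\in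 C_0(\Theta)\quad\text{for all }x\in\mathbb{R}^s,\ 1\le k\le t.$$ For $\mu\in\mathcal{M}(\Theta)$ define $f_\mu:\mathbb{R}^s\to\mathbb{R}^t$ by $$f_\mu(x):=\Bigl(\int_\Theta\mathcal{N}_k(x,\theta)\rho(\theta)\,d\mu(\theta)\Bigr)_{k=1}^t .$$ Let $\mathcal{B}_{\mathcal{N}}:=\{f_\mu:\mu\in\mathcal{M}(\Theta)\}$ with the norm $\|f_\mu\|_{\mathcal{B}_{\mathcal{N}}}:=\inf\{\|\nu\|_{\mathrm{TV}}:\nu\in\mathcal{M}(\Theta),\ f_\nu=f_\mu\}$. Let $\mathcal{S}\subseteq C_0(\Theta)$ be the closure, in the supremum norm, of $\mathrm{span}\{\mathcal{N}_k(x,\cdot)\rho(\cdot):x\in\mathbb{R}^s,\ 1\le k\le t\}$, normed by the supremum norm, and let $\mathcal{S}^\perp:=\{\mu\in\mathcal{M}(\Theta):\int_\Theta g\,d\mu=0\text{ for all }g\in\mathcal{S}\}$. Then $\mathcal{B}_{\mathcal{N}}$ is a Banach space; the map $f_\mu\mapsto\mu+\mathcal{S}^\perp$ is a well-defined linear isometric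 isomorphism from $\mathcal{B}_{\mathcal{N}}$ onto $\mathcal{M}(\Theta)/\mathcal{S}^\perp$ with the quotient norm; and the Banach space $\mathcal{S}$ is a pre-dual of $\mathcal{B}_{\mathcal{N}}$, that is, $\mathcal{S}^*=\mathcal{B}_{\mathcal{N}}$: the map sending $f_\mu$ to the functional $g\mapsto\int_\Theta g\,d\mu$ is a well-defined linear isometric isomorphism from $\mathcal{B}_{\mathcal{N}}$ onto the dual space $\mathcal{S}^*$ with the operator norm. -/

import Mathlib

open MeasureTheory
open scoped Matrix ZeroAtInfty

/-! ### Finite signed Radon measures with the total variation norm -/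

section Radon

variable (X : Type*) [TopologicalSpace X] [TopologicalSpace.PseudoMetrizableSpace X]
  [SigmaCompactSpace X] [MeasurableSpace X] [BorelSpace X]

/-- The total variation measure of a signed measure is finite. -/
instance signedMeasure_isFiniteMeasure_variation {Y : Type*} [MeasurableSpace Y]
    (μ : SignedMeasure Y) : IsFiniteMeasure μ.variation := by
  rw [← SignedMeasure.totalVariation_eq_variation]
  infer_instance

/-- The subspace of those (finite) signed Borel measures whose total variation measure is
Radon: finite on compact sets, outer regular on Borel sets and inner regular on open sets. -/
def radonSubmodule : Submodule ℝ (SignedMeasure X) where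
  carrier := {μ | μ.variation.Regular}
  add_mem' _ _ := by
    let _ := TopologicalSpace.pseudoMetrizableSpacePseudoMetric X
    simp only [Set.mem_ofPred_eq]
    infer_instance
  zero_mem' := by
    let _ := TopologicalSpace.pseudoMetrizableSpacePseudoMetric X
    simp only [Set.mem_ofPred_eq]
    infer_instance
  smul_mem' _ _ _ := by
    let _ := TopologicalSpace.pseudoMetrizableSpacePseudoMetric X
    simp only [Set.mem_ofPred_eq]
    infer_instance

/-- The space `M(X)` of finite signed Radon measures on `X`. -/
def RadonMeasure : Type _ := ↥(radonSubmodule X)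

namespace RadonMeasure

instance : AddCommGroup (RadonMeasure X) := inferInstanceAs (AddCommGroup ↥(radonSubmodule X))

instance : Module ℝ (RadonMeasure X) := inferInstanceAs (Module ℝ ↥(radonSubmodule X))

variable {X}

/-- The underlying signed measure. -/
def toSigned (μ : RadonMeasure X) : SignedMeasure X := μ.1

theorem toSigned_injective : Function.Injective (toSigned (X := X)) := Subtype.val_injective

@[simp] theorem toSigned_zero : (0 : RadonMeasure X).toSigned = 0 := rfl

@[simp] theorem toSigned_add (μ ν : RadonMeasure X) :
    (μ + ν).toSigned = μ.toSigned + ν.toSigned := rfl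

@[simp] theorem toSigned_neg (μ : RadonMeasure X) : (-μ).toSigned = -μ.toSigned := rfl

@[simp] theorem toSigned_smul (c : ℝ) (μ : RadonMeasure X) :
    (c • μ).toSigned = c • μ.toSigned := rfl

/-- The total variation norm `‖μ‖_TV = |μ|(X)`. -/
noncomputable def tvNorm (μ : RadonMeasure X) : ℝ := μ.toSigned.variation.real Set.univ

noncomputable instance : NormedAddCommGroup (RadonMeasure X) :=
  AddGroupNorm.toNormedAddCommGroup
    { toFun := tvNorm
      map_zero' := by simp [tvNorm]
      add_le' := fun μ ν => by
        have h := VectorMeasure.variation_add_le (μ := μ.toSigned) (ν := ν.toSigned) Set.univ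
        simp only [tvNorm, toSigned_add, Measure.real]
        rw [← ENNReal.toReal_add (measure_ne_top _ _) (measure_ne_top _ _)]
        exact ENNReal.toReal_mono (by finiteness) (by simpa using h)
      neg' := fun μ => by simp [tvNorm]
      eq_zero_of_map_eq_zero' := fun μ h => by
        apply toSigned_injective
        have h' : μ.toSigned.variation = 0 := by
          rw [← Measure.measure_univ_eq_zero]
          exact (measureReal_eq_zero_iff (measure_ne_top _ _)).1 h
        simpa using h' }

theorem norm_def (μ : RadonMeasure X) : ‖μ‖ = μ.toSigned.variation.real Set.univ := rfl

noncomputable instance : NormedSpace ℝ (RadonMeasure X) where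
  norm_smul_le c μ := by
    simp only [norm_def, toSigned_smul, VectorMeasure.variation_smul]
    simp [Measure.real]

/-- The pairing `⟨μ, g⟩ = ∫ g dμ`. -/
noncomputable def pairing (μ : RadonMeasure X) (g : X → ℝ) : ℝ := ∫ᵛ θ, g θ ∂•μ.toSigned

end RadonMeasure

end Radon

/-! ### Deep neural networks -/

/-- The parameter space of networks of depth `L + 1` (that is, with `L` hidden layers) with layer
widths `m 0, m 1, …, m (L + 1)`: the lists `(W_j, b_j)`, `j = 1, …, L + 1`, of weight matrices
`W_j ∈ ℝ^(m j × m (j - 1))` and bias vectors `b_j ∈ ℝ^(m j)` (here `j` is shifted by one). -/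
def Params (L : ℕ) (m : ℕ → ℕ) : Type :=
  (j : Fin (L + 1)) → Matrix (Fin (m (j + 1))) (Fin (m j)) ℝ × (Fin (m (j + 1)) → ℝ)

namespace Params

variable (L : ℕ) (m : ℕ → ℕ)

/-- The Euclidean (product) topology, with its Borel σ-algebra. -/
instance : TopologicalSpace (Params L m) := inferInstanceAs (TopologicalSpace
  ((j : Fin (L + 1)) → Matrix (Fin (m (j + 1))) (Fin (m j)) ℝ × (Fin (m (j + 1)) → ℝ)))

instance : MeasurableSpace (Params L m) := borel _

instance : BorelSpace (Params L m) := ⟨rfl⟩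

instance : TopologicalSpace.MetrizableSpace (Params L m) :=
  inferInstanceAs (TopologicalSpace.MetrizableSpace
    ((j : Fin (L + 1)) → (Fin (m (j + 1)) → Fin (m j) → ℝ) × (Fin (m (j + 1)) → ℝ)))

instance : LocallyCompactSpace (Params L m) := inferInstanceAs (LocallyCompactSpace
  ((j : Fin (L + 1)) → (Fin (m (j + 1)) → Fin (m j) → ℝ) × (Fin (m (j + 1)) → ℝ)))

instance : SecondCountableTopology (Params L m) := inferInstanceAs (SecondCountableTopology
  ((j : Fin (L + 1)) → (Fin (m (j + 1)) → Fin (m j) → ℝ) × (Fin (m (j + 1)) → ℝ)))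

end Params

/-- `layer σ θ x j` is `N^(j + 1)(x)`, where `N^1(x) = W_1 x + b_1` and
`N^(j + 1)(x) = W_(j + 1) σ(N^j(x)) + b_(j + 1)`, with `σ` acting componentwise. -/
def layer {L : ℕ} {m : ℕ → ℕ} (σ : ℝ → ℝ) (θ : Params L m) (x : Fin (m 0) → ℝ) :
    (j : ℕ) → j < L + 1 → (Fin (m (j + 1)) → ℝ)
  | 0, h => (θ ⟨0, h⟩).1 *ᵥ x + (θ ⟨0, h⟩).2
  | j + 1, h =>
      (θ ⟨j + 1, h⟩).1 *ᵥ (fun i => σ (layer σ θ x j (Nat.lt_of_succ_lt h) i)) + (θ ⟨j + 1, h⟩).2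

/-- The network `N(x, θ)` of depth `L + 1`, with input `x ∈ ℝ^(m 0)` and output in
`ℝ^(m (L + 1))`. -/
def network {L : ℕ} {m : ℕ → ℕ} (σ : ℝ → ℝ) (x : Fin (m 0) → ℝ) (θ : Params L m) :
    Fin (m (L + 1)) → ℝ :=
  layer σ θ x L (Nat.lt_succ_self L)

/-! ### The space of integral networks and its candidate pre-dual -/

section Spaces

variable {L : ℕ} {m : ℕ → ℕ} (σ : ℝ → ℝ) (ρ : Params L m → ℝ)

/-- The function `θ ↦ N_k(x, θ) ρ(θ)`. -/
def weighted (x : Fin (m 0) → ℝ) (k : Fin (m (L + 1))) : Params L m → ℝ :=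
  fun θ => network σ x θ k * ρ θ

/-- All the functions `N_k(x, ·) ρ` belong to `C₀(Θ)`. -/
def WeightedMemC0 : Prop :=
  ∀ (x : Fin (m 0) → ℝ) (k : Fin (m (L + 1))), ∃ g : C₀(Params L m, ℝ), ⇑g = weighted σ ρ x k

/-- `f_μ(x) = (∫ N_k(x, θ) ρ(θ) dμ(θ))_k`. -/
noncomputable def integralNetwork (μ : RadonMeasure (Params L m)) :
    (Fin (m 0) → ℝ) → (Fin (m (L + 1)) → ℝ) :=
  fun x k => μ.pairing (weighted σ ρ x k)

/-- The closed subspace `S` of `C₀(Θ)`: the closure, in the supremum norm, of the linear span of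
the functions `N_k(x, ·) ρ`. -/
noncomputable def preDualSubmodule : Submodule ℝ C₀(Params L m, ℝ) :=
  (Submodule.span ℝ {g : C₀(Params L m, ℝ) | ∃ x k, ⇑g = weighted σ ρ x k}).topologicalClosure

/-- The space `S` as a type, normed by the supremum norm of `C₀(Θ)`. -/
def PreDual : Type := ↥(preDualSubmodule σ ρ)

namespace PreDual

noncomputable instance : NormedAddCommGroup (PreDual σ ρ) :=
  inferInstanceAs (NormedAddCommGroup ↥(preDualSubmodule σ ρ))

noncomputable instance : NormedSpace ℝ (PreDual σ ρ) :=
  inferInstanceAs (NormedSpace ℝ ↥(preDualSubmodule σ ρ))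

variable {σ ρ}

/-- The underlying element of `C₀(Θ)`. -/
def toC0 (g : PreDual σ ρ) : C₀(Params L m, ℝ) := g.1

theorem norm_def (g : PreDual σ ρ) : ‖g‖ = ‖g.toC0‖ := rfl

end PreDual

end Spaces

section Pairing

theorem c0_integrable {X : Type*} [TopologicalSpace X] [MeasurableSpace X] [BorelSpace X]
    (μ : SignedMeasure X) (g : C₀(X, ℝ)) : μ.Integrable g :=
  BoundedContinuousFunction.integrable _ g.toBCF

variable {X : Type*} [TopologicalSpace X] [TopologicalSpace.PseudoMetrizableSpace X]
  [SigmaCompactSpace X] [MeasurableSpace X] [BorelSpace X]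

theorem pairing_add (μ ν : RadonMeasure X) (g : C₀(X, ℝ)) :
    (μ + ν).pairing g = μ.pairing g + ν.pairing g :=
  VectorMeasure.integral_add_vectorMeasure (c0_integrable _ g) (c0_integrable _ g)

theorem pairing_smul (c : ℝ) (μ : RadonMeasure X) (g : C₀(X, ℝ)) :
    (c • μ).pairing g = c * μ.pairing g :=
  VectorMeasure.integral_smul_vectorMeasure _ c

theorem pairing_zero (g : X → ℝ) : (0 : RadonMeasure X).pairing g = 0 :=
  VectorMeasure.integral_zero_vectorMeasure

theorem abs_pairing_le (μ : RadonMeasure X) (g : C₀(X, ℝ)) :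
    |μ.pairing g| ≤ ‖g‖ * ‖μ‖ := by
  have h1 := VectorMeasure.norm_integral_le_of_norm_le_const (μ := μ.toSigned) (f := g)
    (B := ContinuousLinearMap.lsmul ℝ ℝ) (C := ‖g‖)
    (Filter.Eventually.of_forall fun x => g.toBCF.norm_coe_le_norm x)
  have h2 : ‖(ContinuousLinearMap.lsmul ℝ ℝ : ℝ →L[ℝ] ℝ →L[ℝ] ℝ)‖ ≤ 1 :=
    ContinuousLinearMap.opNorm_lsmul_le
  calc |μ.pairing g| ≤ ‖g‖ * ‖(ContinuousLinearMap.lsmul ℝ ℝ : ℝ →L[ℝ] ℝ →L[ℝ] ℝ)‖ * ‖μ‖ := h1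
    _ ≤ ‖g‖ * 1 * ‖μ‖ := by gcongr
    _ = ‖g‖ * ‖μ‖ := by rw [mul_one]

/-- The annihilator `S^⊥ = {μ ∈ M(X) : ∫ g dμ = 0 for all g ∈ S}` of a subspace `S` of `C₀(X)`. -/
noncomputable def annihilator (S : Submodule ℝ C₀(X, ℝ)) : Submodule ℝ (RadonMeasure X) where
  carrier := {μ | ∀ g ∈ S, μ.pairing g = 0}
  add_mem' hμ hν g hg := by rw [pairing_add, hμ g hg, hν g hg, add_zero]
  zero_mem' g _ := pairing_zero g
  smul_mem' c μ hμ g hg := by rw [pairing_smul, hμ g hg, mul_zero]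

end Pairing

section HypothesisSpace

variable {L : ℕ} {m : ℕ → ℕ} {σ : ℝ → ℝ} {ρ : Params L m → ℝ}

theorem integralNetwork_add (h : WeightedMemC0 σ ρ) (μ ν : RadonMeasure (Params L m)) :
    integralNetwork σ ρ (μ + ν) = integralNetwork σ ρ μ + integralNetwork σ ρ ν := by
  funext x k
  obtain ⟨g, hg⟩ := h x k
  simp only [integralNetwork, Pi.add_apply, ← hg, pairing_add]

theorem integralNetwork_smul (h : WeightedMemC0 σ ρ) (c : ℝ) (μ : RadonMeasure (Params L m)) :
    integralNetwork σ ρ (c • μ) = c • integralNetwork σ ρ μ := by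
  funext x k
  obtain ⟨g, hg⟩ := h x k
  simp only [integralNetwork, Pi.smul_apply, ← hg, pairing_smul, smul_eq_mul]

theorem integralNetwork_zero : integralNetwork σ ρ (0 : RadonMeasure (Params L m)) = 0 := by
  funext x k
  exact pairing_zero _

/-- The vector space of functions `{f_μ : μ ∈ M(Θ)}`. -/
def hypothesisSubmodule (h : WeightedMemC0 σ ρ) :
    Submodule ℝ ((Fin (m 0) → ℝ) → (Fin (m (L + 1)) → ℝ)) where
  carrier := Set.range (integralNetwork σ ρ)
  add_mem' := by
    rintro _ _ ⟨μ, rfl⟩ ⟨ν, rfl⟩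
    exact ⟨μ + ν, integralNetwork_add h μ ν⟩
  zero_mem' := ⟨0, integralNetwork_zero⟩
  smul_mem' := by
    rintro c _ ⟨μ, rfl⟩
    exact ⟨c • μ, integralNetwork_smul h c μ⟩

/-- The space `B_N`. It is a separate type, so that its only norm and topology are those of the
norm defined below (and not those of pointwise convergence). -/
def HypothesisSpace (h : WeightedMemC0 σ ρ) : Type := ↥(hypothesisSubmodule h)

namespace HypothesisSpace

variable {h : WeightedMemC0 σ ρ}

instance : AddCommGroup (HypothesisSpace h) :=
  inferInstanceAs (AddCommGroup ↥(hypothesisSubmodule h))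

instance : Module ℝ (HypothesisSpace h) :=
  inferInstanceAs (Module ℝ ↥(hypothesisSubmodule h))

/-- The underlying function from `ℝ^(m 0)` to `ℝ^(m (L + 1))`. -/
def toFunction (f : HypothesisSpace h) : (Fin (m 0) → ℝ) → (Fin (m (L + 1)) → ℝ) := f.1

variable (h) in
/-- `f_μ` as an element of `B_N`. -/
noncomputable def ofMeasure (μ : RadonMeasure (Params L m)) : HypothesisSpace h :=
  ⟨integralNetwork σ ρ μ, μ, rfl⟩

/-- `‖f‖ = inf {‖ν‖_TV : ν ∈ M(Θ), f_ν = f}`. -/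
noncomputable def infNorm (f : HypothesisSpace h) : ℝ :=
  sInf {r | ∃ ν : RadonMeasure (Params L m), integralNetwork σ ρ ν = f.toFunction ∧ r = ‖ν‖}

theorem infNorm_bddBelow (f : HypothesisSpace h) :
    BddBelow {r | ∃ ν : RadonMeasure (Params L m),
      integralNetwork σ ρ ν = f.toFunction ∧ r = ‖ν‖} :=
  ⟨0, by rintro _ ⟨ν, -, rfl⟩; exact norm_nonneg ν⟩

theorem infNorm_nonneg (f : HypothesisSpace h) : 0 ≤ f.infNorm :=
  Real.sInf_nonneg (by rintro _ ⟨ν, -, rfl⟩; exact norm_nonneg ν)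

theorem infNorm_le (f : HypothesisSpace h) (ν : RadonMeasure (Params L m))
    (hν : integralNetwork σ ρ ν = f.toFunction) : f.infNorm ≤ ‖ν‖ :=
  csInf_le f.infNorm_bddBelow ⟨ν, hν, rfl⟩

theorem exists_norm_lt (f : HypothesisSpace h) {ε : ℝ} (hε : 0 < ε) :
    ∃ ν : RadonMeasure (Params L m),
      integralNetwork σ ρ ν = f.toFunction ∧ ‖ν‖ < f.infNorm + ε := by
  obtain ⟨μ, hμ⟩ := f.2
  obtain ⟨_, ⟨ν, hν, rfl⟩, hlt⟩ := exists_lt_of_csInf_lt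
    (s := {r | ∃ ν : RadonMeasure (Params L m),
      integralNetwork σ ρ ν = f.toFunction ∧ r = ‖ν‖}) ⟨_, μ, hμ, rfl⟩
    (lt_add_of_pos_right f.infNorm hε)
  exact ⟨ν, hν, hlt⟩

theorem infNorm_smul_le (c : ℝ) (f : HypothesisSpace h) :
    (c • f).infNorm ≤ |c| * f.infNorm := by
  refine le_of_forall_pos_lt_add fun ε hε => ?_
  obtain ⟨ν, hν, hlt⟩ := f.exists_norm_lt (ε := ε / (|c| + 1)) (by positivity)
  have h1 : (c • f).infNorm ≤ ‖c • ν‖ :=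
    infNorm_le _ _ (by rw [integralNetwork_smul h, hν]; rfl)
  rw [norm_smul, Real.norm_eq_abs] at h1
  have h2 : |c| * ‖ν‖ ≤ |c| * (f.infNorm + ε / (|c| + 1)) := by gcongr
  have h3 : |c| * (ε / (|c| + 1)) < ε := by
    rw [← mul_div_assoc, div_lt_iff₀ (by positivity)]
    nlinarith
  linarith

noncomputable instance : NormedAddCommGroup (HypothesisSpace h) :=
  AddGroupNorm.toNormedAddCommGroup
    { toFun := infNorm
      map_zero' := le_antisymm
        (by simpa using infNorm_le (0 : HypothesisSpace h) 0 integralNetwork_zero)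
        (infNorm_nonneg _)
      add_le' := fun f g => by
        refine le_of_forall_pos_lt_add fun ε hε => ?_
        obtain ⟨μ, hμ, hμ'⟩ := f.exists_norm_lt (half_pos hε)
        obtain ⟨ν, hν, hν'⟩ := g.exists_norm_lt (half_pos hε)
        have h1 : (f + g).infNorm ≤ ‖μ + ν‖ :=
          infNorm_le _ _ (by rw [integralNetwork_add h, hμ, hν]; rfl)
        linarith [norm_add_le μ ν]
      neg' := fun f => by
        have key : ∀ f : HypothesisSpace h, (-f).infNorm ≤ f.infNorm := fun f => by
          simpa using infNorm_smul_le (-1) f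
        exact le_antisymm (key f) (by simpa using key (-f))
      eq_zero_of_map_eq_zero' := fun f hf => by
        apply Subtype.ext
        funext x k
        obtain ⟨g, hg⟩ := h x k
        change f.toFunction x k = 0
        rw [← abs_nonpos_iff]
        refine le_of_forall_pos_lt_add fun ε hε => ?_
        obtain ⟨ν, hν, hlt⟩ := f.exists_norm_lt (ε := ε / (‖g‖ + 1)) (by positivity)
        change f.infNorm = 0 at hf
        rw [hf, zero_add, lt_div_iff₀ (by positivity)] at hlt
        have h1 : |f.toFunction x k| ≤ ‖g‖ * ‖ν‖ := by
          rw [← hν]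
          simp only [integralNetwork, ← hg]
          exact abs_pairing_le ν g
        nlinarith [norm_nonneg ν] }

theorem norm_def (f : HypothesisSpace h) :
    ‖f‖ = sInf {r | ∃ ν : RadonMeasure (Params L m),
      integralNetwork σ ρ ν = f.toFunction ∧ r = ‖ν‖} := rfl

noncomputable instance : NormedSpace ℝ (HypothesisSpace h) where
  norm_smul_le c f := infNorm_smul_le c f

end HypothesisSpace

end HypothesisSpace

/-! Two linear maps leave `M(Θ)`: `μ ↦ f_μ` onto `B_N`, and `μ ↦ (g ↦ ∫ g dμ)` into `S^*`. Both have
kernel `S^⊥`, because a bounded functional kills `S` as soon as it kills the spanning functions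
`N_k(x, ·) ρ`. The infimum norm on `B_N` is then the quotient norm of `M(Θ) / S^⊥`. For `S^*`, the
estimate `|∫ g dμ| ≤ ‖g‖ ‖μ‖` gives one inequality. The other, together with surjectivity, follows
from Hahn–Banach and the Riesz theorem: each `ℓ` in `S^*` is integration against a measure of norm
at most `‖ℓ‖`. The Riesz theorem for signed functionals (`RadonMeasure.exists_pairingCLM_eq`) is
reduced to the positive case by a Jordan decomposition `ℓ = Λ₁ - Λ₂` on nonnegative compactly
supported functions. The combined mass of the two representing measures must be at most `‖ℓ‖`, with
no constant lost, since otherwise the isometry would fail. -/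

open scoped NNReal CompactlySupported

/-! ### The Riesz representation theorem for bounded functionals on `C₀(X)` -/

/-! ### Jordan decomposition of order bounded functionals on nonnegative functions. -/

namespace CompactlySupportedContinuousMap

variable {X : Type*} [TopologicalSpace X]

/-- **Riesz decomposition property**: a function dominated by `f₁ + f₂` is a sum of functions
dominated by `f₁` and `f₂`. -/
theorem exists_add_of_le_add {g f₁ f₂ : C_c(X, ℝ≥0)} (hg : g ≤ f₁ + f₂) :
    ∃ g₁ g₂, g₁ ≤ f₁ ∧ g₂ ≤ f₂ ∧ g₁ + g₂ = g := by
  -- Take `g₁ = g ⊓ f₁`; the remainder `k` is the truncated difference `g - f₁`, hence below `f₂`.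
  obtain ⟨k, hk⟩ := CompactlySupportedContinuousMap.exists_add_of_le (inf_le_left : g ⊓ f₁ ≤ g)
  refine ⟨g ⊓ f₁, k, inf_le_right, fun x => ?_, hk⟩
  have h1 : g x ≤ f₁ x + f₂ x := hg x
  have h2 : min (g x) (f₁ x) + k x = g x := DFunLike.congr_fun hk x
  rcases le_total (g x) (f₁ x) with h | h
  · rw [min_eq_left h] at h2
    have : k x = 0 := by simpa using h2
    simp [this]
  · rw [min_eq_right h] at h2
    exact le_of_add_le_add_left (h2.trans_le h1)

/-- The value at `f` of the positive part of a functional `φ`: the supremum of `φ g` over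
`0 ≤ g ≤ f`. -/
noncomputable def posPartValue (φ : C_c(X, ℝ≥0) →ₗ[ℝ≥0] ℝ) (f : C_c(X, ℝ≥0)) : ℝ :=
  sSup (φ '' Set.Iic f)

variable {φ : C_c(X, ℝ≥0) →ₗ[ℝ≥0] ℝ}

theorem le_posPartValue (hφ : ∀ f, BddAbove (φ '' Set.Iic f))
    {f g : C_c(X, ℝ≥0)} (h : g ≤ f) : φ g ≤ posPartValue φ f :=
  le_csSup (hφ f) ⟨g, h, rfl⟩

theorem posPartValue_le {f : C_c(X, ℝ≥0)} {c : ℝ} (h : ∀ g ≤ f, φ g ≤ c) :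
    posPartValue φ f ≤ c :=
  csSup_le ⟨_, f, Set.mem_Iic.2 le_rfl, rfl⟩ (by rintro _ ⟨g, hg, rfl⟩; exact h g hg)

theorem posPartValue_nonneg (hφ : ∀ f, BddAbove (φ '' Set.Iic f))
    (f : C_c(X, ℝ≥0)) : 0 ≤ posPartValue φ f := by
  simpa using le_posPartValue hφ (f := f) (g := 0) fun x => zero_le

/-- Subadditivity is the Riesz decomposition property; superadditivity adds competitors for `f₁` and
`f₂`. -/
theorem posPartValue_add (hφ : ∀ f, BddAbove (φ '' Set.Iic f))
    (f₁ f₂ : C_c(X, ℝ≥0)) :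
    posPartValue φ (f₁ + f₂) = posPartValue φ f₁ + posPartValue φ f₂ := by
  apply le_antisymm
  · refine posPartValue_le fun g hg => ?_
    obtain ⟨g₁, g₂, h₁, h₂, rfl⟩ := exists_add_of_le_add hg
    rw [map_add]
    exact add_le_add (le_posPartValue hφ h₁) (le_posPartValue hφ h₂)
  · rw [← le_sub_iff_add_le]
    refine posPartValue_le fun g₁ h₁ => ?_
    rw [le_sub_comm]
    refine posPartValue_le fun g₂ h₂ => ?_
    rw [le_sub_iff_add_le, add_comm, ← map_add]
    exact le_posPartValue hφ fun x => add_le_add (h₁ x) (h₂ x)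

/-- Scaling a competitor for `f` by `c` gives one for `c • f`. The reverse inequality is this one
applied to `c⁻¹` and `c • f`. -/
theorem smul_posPartValue_le (hφ : ∀ f, BddAbove (φ '' Set.Iic f))
    (c : ℝ≥0) (f : C_c(X, ℝ≥0)) :
    c * posPartValue φ f ≤ posPartValue φ (c • f) := by
  rcases eq_or_ne c 0 with rfl | hc
  · simpa using posPartValue_nonneg hφ _
  · have hc' : 0 < (c : ℝ) := by positivity
    rw [← le_div_iff₀' hc']
    refine posPartValue_le fun g hg => ?_
    rw [le_div_iff₀' hc']
    have h := le_posPartValue hφ (f := c • f) (g := c • g) fun x => by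
      simpa using mul_le_mul_right (hg x) c
    rwa [map_smul, NNReal.smul_def, smul_eq_mul] at h

theorem posPartValue_smul (hφ : ∀ f, BddAbove (φ '' Set.Iic f))
    (c : ℝ≥0) (f : C_c(X, ℝ≥0)) :
    posPartValue φ (c • f) = c * posPartValue φ f := by
  refine le_antisymm ?_ (smul_posPartValue_le hφ c f)
  rcases eq_or_ne c 0 with rfl | hc
  · refine posPartValue_le fun g hg => ?_
    have : g = 0 := by
      ext x
      have : g x ≤ 0 := by simpa using hg x
      simp [le_antisymm this zero_le]
    simp [this]
  · have hc' : 0 < (c : ℝ) := by positivity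
    have h := smul_posPartValue_le hφ c⁻¹ (c • f)
    rwa [smul_smul, inv_mul_cancel₀ hc, one_smul, NNReal.coe_inv, inv_mul_le_iff₀ hc'] at h

/-- An order bounded functional is a difference of positive functionals `Λ₁` and `Λ₂`, with
`Λ₁ + Λ₂` controlled by the values of the functional on differences. -/
theorem exists_positive_sub_positive (hφ : ∀ f, BddAbove (φ '' Set.Iic f)) :
    ∃ Λ₁ Λ₂ : C_c(X, ℝ≥0) →ₗ[ℝ≥0] ℝ≥0, (∀ f, φ f = Λ₁ f - Λ₂ f) ∧
      ∀ f (c : ℝ), (∀ g h, g + h = f → φ g - φ h ≤ c) → Λ₁ f + Λ₂ f ≤ c := by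
  refine ⟨⟨⟨fun f => ⟨posPartValue φ f, posPartValue_nonneg hφ f⟩, fun f g => ?_⟩, fun c f => ?_⟩,
    ⟨⟨fun f => ⟨posPartValue φ f - φ f, sub_nonneg.2 (le_posPartValue hφ le_rfl)⟩,
      fun f g => ?_⟩, fun c f => ?_⟩, fun f => ?_, fun f c h => ?_⟩
  · exact Subtype.ext (posPartValue_add hφ f g)
  · exact Subtype.ext (posPartValue_smul hφ c f)
  · apply Subtype.ext
    change posPartValue φ (f + g) - φ (f + g) =
      (posPartValue φ f - φ f) + (posPartValue φ g - φ g)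
    rw [posPartValue_add hφ, map_add]
    ring
  · apply Subtype.ext
    change posPartValue φ (c • f) - φ (c • f) = c * (posPartValue φ f - φ f)
    rw [posPartValue_smul hφ, map_smul, NNReal.smul_def, smul_eq_mul]
    ring
  · change φ f = posPartValue φ f - (posPartValue φ f - φ f)
    ring
  · change posPartValue φ f + (posPartValue φ f - φ f) ≤ c
    -- With `f = g + k`, add `φ g - φ k ≤ c` to `φ g + φ k = φ f`: this gives `2 φ g ≤ c + φ f`.
    have : posPartValue φ f ≤ (c + φ f) / 2 := posPartValue_le fun g hg => by
      obtain ⟨k, rfl⟩ := CompactlySupportedContinuousMap.exists_add_of_le hg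
      have := h g k rfl
      rw [map_add]
      linarith
    linarith

end CompactlySupportedContinuousMap

/-! ### Approximation in `C₀(X)` by compactly supported functions. -/

namespace ZeroAtInftyContinuousMap

variable {X : Type*} [TopologicalSpace X]

theorem norm_le_of_forall {f : C₀(X, ℝ)} {c : ℝ} (hc : 0 ≤ c) (h : ∀ x, |f x| ≤ c) : ‖f‖ ≤ c :=
  (BoundedContinuousFunction.norm_le hc (f := f.toBCF)).2 h

/-- The inclusion of the nonnegative compactly supported functions into `C₀(X)`. -/
noncomputable def ofNNReal : C_c(X, ℝ≥0) →ₗ[ℝ≥0] C₀(X, ℝ) where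
  toFun f := (f.toReal : C₀(X, ℝ))
  map_add' f g := by ext x; simp
  map_smul' c f := by ext x; simp

@[simp] theorem ofNNReal_apply (f : C_c(X, ℝ≥0)) (x : X) : ofNNReal f x = f x :=
  f.toReal_apply x

theorem norm_ofNNReal_le_of_le {f g : C_c(X, ℝ≥0)} (h : g ≤ f) : ‖ofNNReal g‖ ≤ ‖ofNNReal f‖ :=
  norm_le_of_forall (norm_nonneg _) fun x => by
    have h1 : |ofNNReal f x| ≤ ‖ofNNReal f‖ := (ofNNReal f).toBCF.norm_coe_le_norm x
    have h2 : g x ≤ f x := h x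
    rw [ofNNReal_apply, NNReal.abs_eq] at h1 ⊢
    exact le_trans (mod_cast h2) h1

/-- The part of `g` above `ε`, as a compactly supported function. -/
noncomputable def cutoff (g : C₀(X, ℝ)) {ε : ℝ} (hε : 0 < ε) : C_c(X, ℝ≥0) where
  toFun x := (g x - ε).toNNReal
  continuous_toFun := by fun_prop
  hasCompactSupport' := by
    have h : ∀ᶠ x in Filter.cocompact X, g x < ε := (zero_at_infty g).eventually_lt_const hε
    obtain ⟨K, hK, hKs⟩ := Filter.mem_cocompact.1 h
    refine HasCompactSupport.intro' (K := closure (Function.support fun x => (g x - ε).toNNReal))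
      ?_ isClosed_closure fun x hx => by_contra fun h => hx (subset_closure h)
    -- The support lies in this closed set, which is compact because `g < ε` off a compact set.
    have hcl : IsClosed {x | ε ≤ g x} := isClosed_le continuous_const (map_continuous g)
    have hsub : {x | ε ≤ g x} ⊆ K := fun x hx => by_contra fun h =>
      (not_lt.2 hx : ¬ g x < ε) (hKs h)
    refine (hK.of_isClosed_subset hcl hsub).of_isClosed_subset isClosed_closure
      (closure_minimal (fun x hx => ?_) hcl)
    by_contra h
    exact hx (Real.toNNReal_of_nonpos (sub_nonpos.2 (not_le.1 h).le))

theorem coe_cutoff (g : C₀(X, ℝ)) {ε : ℝ} (hε : 0 < ε) (x : X) :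
    (g.cutoff hε x : ℝ) = max (g x - ε) 0 := Real.coe_toNNReal' _

/-- Two bounded functionals on `C₀(X)` agree if they agree on the nonnegative compactly supported
functions. -/
theorem strongDual_ext {φ ψ : StrongDual ℝ C₀(X, ℝ)}
    (h : ∀ f : C_c(X, ℝ≥0), φ (ofNNReal f) = ψ (ofNNReal f)) : φ = ψ := by
  ext g
  rw [← sub_eq_zero, ← abs_nonpos_iff]
  refine le_of_forall_pos_le_add fun δ hδ => ?_
  -- The `+ 1` keeps the denominator positive when `φ = ψ`.
  set ε := δ / (‖φ - ψ‖ + 1) with hε'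
  have hε : 0 < ε := by positivity
  -- Cutting off `g` and `-g` at height `ε` leaves `g` clamped to `[-ε, ε]`.
  have hn : ‖g - (ofNNReal (g.cutoff hε) - ofNNReal ((-g).cutoff hε))‖ ≤ ε :=
    norm_le_of_forall hε.le fun x => by
      simp only [sub_apply, ofNNReal_apply, coe_cutoff, neg_apply]
      rw [abs_le]
      constructor <;> rcases max_cases (g x - ε) 0 with h1 | h1 <;>
        rcases max_cases (-g x - ε) 0 with h2 | h2 <;> linarith
  have h1 := (φ - ψ).le_opNorm (g - (ofNNReal (g.cutoff hε) - ofNNReal ((-g).cutoff hε)))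
  simp only [map_sub, _root_.sub_apply, h, sub_self, sub_zero, Real.norm_eq_abs]
    at h1
  calc |φ g - ψ g| ≤ ‖φ - ψ‖ * ε := h1.trans (by gcongr)
    _ ≤ (‖φ - ψ‖ + 1) * ε := by gcongr; linarith
    _ = 0 + δ := by rw [hε']; field_simp; simp

end ZeroAtInftyContinuousMap

/-! ### From positive functionals to signed Radon measures. -/

section Riesz

open ZeroAtInftyContinuousMap

variable {X : Type*} [TopologicalSpace X] [TopologicalSpace.PseudoMetrizableSpace X]
  [SigmaCompactSpace X] [MeasurableSpace X] [BorelSpace X]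

/-- Integration against a Radon measure, as a bounded functional on `C₀(X)`. -/
noncomputable def RadonMeasure.pairingCLM (μ : RadonMeasure X) : StrongDual ℝ C₀(X, ℝ) :=
  LinearMap.mkContinuous
    { toFun := fun g => μ.pairing g
      map_add' := fun f g => VectorMeasure.integral_add (c0_integrable _ f) (c0_integrable _ g)
      map_smul' := fun c g => VectorMeasure.integral_fun_smul _ _ c g }
    ‖μ‖ fun g => (abs_pairing_le μ g).trans_eq (mul_comm _ _)

theorem RadonMeasure.pairingCLM_apply (μ : RadonMeasure X) (g : C₀(X, ℝ)) :
    μ.pairingCLM g = μ.pairing g := rfl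

/-- The difference of two finite Borel measures, as a Radon measure. -/
noncomputable def RadonMeasure.ofSub (μ ν : Measure X) [IsFiniteMeasure μ] [IsFiniteMeasure ν] :
    RadonMeasure X :=
  ⟨μ.toSignedMeasure - ν.toSignedMeasure, by
    -- Finite Borel measures on such a space are automatically regular.
    let _ := TopologicalSpace.pseudoMetrizableSpacePseudoMetric X
    change (μ.toSignedMeasure - ν.toSignedMeasure).variation.Regular
    infer_instance⟩

theorem RadonMeasure.norm_ofSub_le (μ ν : Measure X) [IsFiniteMeasure μ] [IsFiniteMeasure ν] :
    ‖ofSub μ ν‖ ≤ (μ + ν).real Set.univ := by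
  have h := VectorMeasure.variation_sub_le (μ := μ.toSignedMeasure) (ν := ν.toSignedMeasure)
  simp only [Measure.variation_toSignedMeasure] at h
  exact ENNReal.toReal_mono (by finiteness) (h Set.univ)

theorem RadonMeasure.pairing_ofSub (μ ν : Measure X) [IsFiniteMeasure μ] [IsFiniteMeasure ν]
    (g : C₀(X, ℝ)) : (ofSub μ ν).pairing g = ∫ x, g x ∂μ - ∫ x, g x ∂ν := by
  -- Real multiplication is commutative; the flipped form is the one
  -- `VectorMeasure.integral_toSignedMeasure` rewrites.
  have hflip : (ContinuousLinearMap.lsmul ℝ ℝ : ℝ →L[ℝ] ℝ →L[ℝ] ℝ) =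
      (ContinuousLinearMap.lsmul ℝ ℝ).flip := by
    ext
    simp
  change ∫ᵛ θ, g θ ∂•(μ.toSignedMeasure - ν.toSignedMeasure) = _
  rw [VectorMeasure.integral_sub_vectorMeasure (c0_integrable _ g) (c0_integrable _ g), hflip,
    VectorMeasure.integral_toSignedMeasure, VectorMeasure.integral_toSignedMeasure]

/-- A Borel measure on a `σ`-compact space is bounded by `C` if all integrals of compactly
supported functions with values in `[0, 1]` are. -/
theorem measure_univ_le_of_lintegral_le [T2Space X] [LocallyCompactSpace X] {μ : Measure X}
    {C : ENNReal} (h : ∀ f : C_c(X, ℝ≥0), (∀ x, f x ≤ 1) → ∫⁻ x, f x ∂μ ≤ C) :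
    μ Set.univ ≤ C := by
  rw [← iUnion_compactCovering, Monotone.measure_iUnion (fun _ _ hn => compactCovering_subset X hn)]
  refine iSup_le fun n => ?_
  obtain ⟨f, hf1, -, hfc, hf⟩ := exists_continuous_one_zero_of_isCompact
    (isCompact_compactCovering X n) isClosed_empty (Set.disjoint_empty _)
  let F : C_c(X, ℝ≥0) := CompactlySupportedContinuousMap.nnrealPart ⟨f, hfc⟩
  have hF : ∀ x, F x = (f x).toNNReal := fun x => rfl
  refine le_trans ?_ (h F fun x => by simpa [hF] using (hf x).2)
  rw [← lintegral_indicator_one (isCompact_compactCovering X n).isClosed.measurableSet]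
  refine lintegral_mono fun x => ?_
  by_cases hx : x ∈ compactCovering X n
  · simp [hx, hF, hf1 hx]
  · simp [hx]

/-- **Riesz representation theorem**: every bounded functional on `C₀(X)` is integration against a
finite signed Radon measure of no larger norm. -/
theorem RadonMeasure.exists_pairingCLM_eq [T2Space X] [LocallyCompactSpace X]
    (ℓ : StrongDual ℝ C₀(X, ℝ)) : ∃ μ : RadonMeasure X, μ.pairingCLM = ℓ ∧ ‖μ‖ ≤ ‖ℓ‖ := by
  let φ : C_c(X, ℝ≥0) →ₗ[ℝ≥0] ℝ := (ℓ.toLinearMap.restrictScalars ℝ≥0).comp ofNNReal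
  have hφ : ∀ f, φ f = ℓ (ofNNReal f) := fun f => rfl
  have hbdd : ∀ f, BddAbove (φ '' Set.Iic f) := by
    intro f
    refine ⟨‖ℓ‖ * ‖ofNNReal f‖, ?_⟩
    rintro _ ⟨g, hg, rfl⟩
    exact ((le_abs_self _).trans (ℓ.le_opNorm _)).trans
      (by gcongr; exact norm_ofNNReal_le_of_le hg)
  obtain ⟨Λ₁, Λ₂, hsub, hadd⟩ :=
    CompactlySupportedContinuousMap.exists_positive_sub_positive hbdd
  set μ := NNRealRMK.rieszMeasure Λ₁ with hμ
  set ν := NNRealRMK.rieszMeasure Λ₂ with hν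
  -- Both masses are bounded at once; separate bounds would lose a constant.
  have hmass : (μ + ν) Set.univ ≤ ENNReal.ofReal ‖ℓ‖ := by
    refine measure_univ_le_of_lintegral_le fun f hf => ?_
    rw [lintegral_add_measure, hμ, hν, NNRealRMK.lintegral_rieszMeasure,
      NNRealRMK.lintegral_rieszMeasure, ← ENNReal.coe_add, ← ENNReal.ofReal_coe_nnreal]
    refine ENNReal.ofReal_le_ofReal ?_
    rw [NNReal.coe_add]
    -- If `g, k ≥ 0` and `g + k = f ≤ 1`, then `|g - k| ≤ 1`, so `ℓ (g - k) ≤ ‖ℓ‖`.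
    refine hadd f _ fun g k hgk => ?_
    rw [hφ, hφ, ← map_sub]
    refine (le_abs_self _).trans ((ℓ.le_opNorm _).trans (mul_le_of_le_one_right (norm_nonneg _) ?_))
    refine norm_le_of_forall zero_le_one fun x => ?_
    have h1 : (g x : ℝ) + k x ≤ 1 := by
      have : g x + k x ≤ 1 := by simpa [← hgk] using hf x
      exact_mod_cast this
    simp only [ZeroAtInftyContinuousMap.sub_apply, ofNNReal_apply]
    rw [abs_le]
    constructor <;> linarith [(g x).coe_nonneg, (k x).coe_nonneg]
  rw [Measure.add_apply] at hmass
  have hfin₁ : IsFiniteMeasure μ :=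
    ⟨(le_self_add.trans hmass).trans_lt ENNReal.ofReal_lt_top⟩
  have hfin₂ : IsFiniteMeasure ν :=
    ⟨(le_add_self.trans hmass).trans_lt ENNReal.ofReal_lt_top⟩
  refine ⟨ofSub μ ν, strongDual_ext fun f => ?_, (norm_ofSub_le μ ν).trans ?_⟩
  · rw [pairingCLM_apply, pairing_ofSub, ← hφ, hsub]
    simp only [ofNNReal_apply, hμ, hν, NNRealRMK.integral_rieszMeasure]
  · exact ENNReal.toReal_le_of_le_ofReal (norm_nonneg ℓ) hmass

end Riesz

/-! ### Duality -/

section Duality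

variable {L : ℕ} {m : ℕ → ℕ} {σ : ℝ → ℝ} {ρ : Params L m → ℝ}

/-- Integration against `μ` as a bounded functional on `S`, linearly in `μ`. -/
noncomputable def RadonMeasure.toPreDualDual (σ : ℝ → ℝ) (ρ : Params L m → ℝ) :
    RadonMeasure (Params L m) →ₗ[ℝ] StrongDual ℝ (PreDual σ ρ) where
  toFun μ := μ.pairingCLM.comp (preDualSubmodule σ ρ).subtypeL
  map_add' μ ν := ContinuousLinearMap.ext fun g => pairing_add μ ν g.toC0
  map_smul' c μ := ContinuousLinearMap.ext fun g => pairing_smul c μ g.toC0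

theorem RadonMeasure.norm_toPreDualDual_le (μ : RadonMeasure (Params L m)) :
    ‖toPreDualDual σ ρ μ‖ ≤ ‖μ‖ :=
  ContinuousLinearMap.opNorm_le_bound _ (norm_nonneg _) fun g =>
    (abs_pairing_le μ g.toC0).trans_eq (mul_comm _ _)

/-- Every bounded functional on `S` is integration against a measure of no larger norm. -/
theorem RadonMeasure.exists_toPreDualDual_eq (ℓ : StrongDual ℝ (PreDual σ ρ)) :
    ∃ μ : RadonMeasure (Params L m), toPreDualDual σ ρ μ = ℓ ∧ ‖μ‖ ≤ ‖ℓ‖ := by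
  obtain ⟨ψ, hψ, hnorm⟩ := exists_extension_norm_eq (preDualSubmodule σ ρ) ℓ
  obtain ⟨μ, hμ, hle⟩ := RadonMeasure.exists_pairingCLM_eq ψ
  refine ⟨μ, ContinuousLinearMap.ext fun g => ?_, hle.trans_eq hnorm⟩
  exact (DFunLike.congr_fun hμ g.toC0).trans (hψ g)

theorem RadonMeasure.toPreDualDual_eq_zero_iff (μ : RadonMeasure (Params L m)) :
    toPreDualDual σ ρ μ = 0 ↔ μ ∈ annihilator (preDualSubmodule σ ρ) :=
  ⟨fun h g hg => DFunLike.congr_fun h (⟨g, hg⟩ : PreDual σ ρ),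
    fun h => ContinuousLinearMap.ext fun g => h g.1 g.2⟩

/-- The annihilator of `S` consists of the measures with vanishing integral network. -/
theorem mem_annihilator_preDual_iff (h : WeightedMemC0 σ ρ) (μ : RadonMeasure (Params L m)) :
    μ ∈ annihilator (preDualSubmodule σ ρ) ↔ integralNetwork σ ρ μ = 0 := by
  constructor
  · intro hμ
    funext x k
    obtain ⟨g, hg⟩ := h x k
    have := hμ g (Submodule.le_topologicalClosure _ (Submodule.subset_span ⟨x, k, hg⟩))
    rwa [hg] at this
  · intro hμ g hg
    have hcl : preDualSubmodule σ ρ ≤ LinearMap.ker μ.pairingCLM.toLinearMap :=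
      Submodule.topologicalClosure_minimal _ (Submodule.span_le.2 fun f ⟨x, k, hf⟩ => by
        change μ.pairing f = 0
        rw [hf]
        exact congrFun (congrFun hμ x) k) μ.pairingCLM.isClosed_ker
    exact hcl hg

namespace HypothesisSpace

variable (h : WeightedMemC0 σ ρ)

/-- The map `μ ↦ f_μ`. -/
noncomputable def ofMeasureLinear : RadonMeasure (Params L m) →ₗ[ℝ] HypothesisSpace h where
  toFun := ofMeasure h
  map_add' μ ν := Subtype.ext (integralNetwork_add h μ ν)
  map_smul' c μ := Subtype.ext (integralNetwork_smul h c μ)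

theorem ofMeasureLinear_surjective : Function.Surjective (ofMeasureLinear h) := by
  rintro ⟨_, μ, rfl⟩
  exact ⟨μ, rfl⟩

theorem ker_ofMeasureLinear :
    LinearMap.ker (ofMeasureLinear h) = annihilator (preDualSubmodule σ ρ) := by
  ext μ
  rw [mem_annihilator_preDual_iff h, LinearMap.mem_ker]
  exact Subtype.ext_iff

theorem ker_toPreDualDual :
    LinearMap.ker (RadonMeasure.toPreDualDual σ ρ) = annihilator (preDualSubmodule σ ρ) := by
  ext μ
  exact RadonMeasure.toPreDualDual_eq_zero_iff μ

/-- The algebraic isomorphism `f_μ ↦ μ + S^⊥`. -/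
noncomputable def equivQuotient : HypothesisSpace h ≃ₗ[ℝ]
    (RadonMeasure (Params L m) ⧸ annihilator (preDualSubmodule σ ρ)) :=
  ((Submodule.quotEquivOfEq _ _ (ker_ofMeasureLinear h).symm).trans
    ((ofMeasureLinear h).quotKerEquivOfSurjective (ofMeasureLinear_surjective h))).symm

theorem equivQuotient_ofMeasure (μ : RadonMeasure (Params L m)) :
    equivQuotient h (ofMeasure h μ) = Submodule.Quotient.mk μ :=
  (LinearEquiv.symm_apply_eq _).2 rfl

/-- Both norms are infima of `‖ν‖` over the same set: the fibre of `μ ↦ f_μ` through `μ` is the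
coset `μ + S^⊥`. -/
theorem norm_equivQuotient (f : HypothesisSpace h) : ‖equivQuotient h f‖ = ‖f‖ := by
  obtain ⟨μ, rfl⟩ := ofMeasureLinear_surjective h f
  change ‖equivQuotient h (ofMeasure h μ)‖ = ‖ofMeasure h μ‖
  rw [equivQuotient_ofMeasure]
  have key : ∀ ν, integralNetwork σ ρ ν = (ofMeasure h μ).toFunction ↔
      (Submodule.Quotient.mk ν : RadonMeasure (Params L m) ⧸ annihilator (preDualSubmodule σ ρ))
        = Submodule.Quotient.mk μ := fun ν => by
    rw [← equivQuotient_ofMeasure h, ← equivQuotient_ofMeasure h, (equivQuotient h).injective.eq_iff]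
    exact (Subtype.ext_iff (a1 := ofMeasure h ν) (a2 := ofMeasure h μ)).symm
  apply le_antisymm
  · refine le_of_forall_pos_lt_add fun ε hε => ?_
    obtain ⟨ν, hν, hlt⟩ := (ofMeasure h μ).exists_norm_lt hε
    rw [← (key ν).1 hν]
    exact (Submodule.Quotient.norm_mk_le _ ν).trans_lt hlt
  · refine le_of_forall_pos_lt_add fun ε hε => ?_
    obtain ⟨ν, hν, hlt⟩ := Submodule.Quotient.norm_mk_lt
      (Submodule.Quotient.mk μ : RadonMeasure (Params L m) ⧸ annihilator (preDualSubmodule σ ρ)) hε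
    exact (infNorm_le _ ν ((key ν).2 hν)).trans_lt hlt

/-- The algebraic isomorphism `f_μ ↦ (g ↦ ∫ g dμ)`. -/
noncomputable def equivDual : HypothesisSpace h ≃ₗ[ℝ] StrongDual ℝ (PreDual σ ρ) :=
  (equivQuotient h).trans ((Submodule.quotEquivOfEq _ _ ker_toPreDualDual.symm).trans
    ((RadonMeasure.toPreDualDual σ ρ).quotKerEquivOfSurjective fun ℓ =>
      (RadonMeasure.exists_toPreDualDual_eq ℓ).imp fun _ hμ => hμ.1))

theorem equivDual_ofMeasure (μ : RadonMeasure (Params L m)) :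
    equivDual h (ofMeasure h μ) = RadonMeasure.toPreDualDual σ ρ μ := by
  rw [equivDual, LinearEquiv.trans_apply, equivQuotient_ofMeasure]
  rfl

/-- Every representing measure bounds the functional from above, and the Riesz representative has
norm at most that of the functional, so it attains the infimum. -/
theorem norm_equivDual (f : HypothesisSpace h) : ‖equivDual h f‖ = ‖f‖ := by
  apply le_antisymm
  · refine le_of_forall_pos_lt_add fun ε hε => ?_
    obtain ⟨ν, hν, hlt⟩ := f.exists_norm_lt hε
    obtain rfl : ofMeasure h ν = f := Subtype.ext hν
    rw [equivDual_ofMeasure]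
    exact ν.norm_toPreDualDual_le.trans_lt hlt
  · obtain ⟨ν, hν, hle⟩ := RadonMeasure.exists_toPreDualDual_eq (equivDual h f)
    rw [← equivDual_ofMeasure h, (equivDual h).injective.eq_iff] at hν
    exact (infNorm_le f ν (congrArg toFunction hν)).trans hle

end HypothesisSpace

end Duality

theorem mainTheorem2 (L : ℕ) (m : ℕ → ℕ) (σ : ℝ → ℝ) (hσ : Continuous σ)
    (ρ : Params L m → ℝ) (hρ : Continuous ρ) (hρpos : ∀ θ, 0 < ρ θ)
    (h : WeightedMemC0 σ ρ) :
    CompleteSpace (HypothesisSpace h) ∧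
    (∃ φ : HypothesisSpace h ≃ₗᵢ[ℝ]
          (RadonMeasure (Params L m) ⧸ annihilator (preDualSubmodule σ ρ)),
      ∀ μ : RadonMeasure (Params L m),
        φ (HypothesisSpace.ofMeasure h μ) = Submodule.Quotient.mk μ) ∧
    CompleteSpace (PreDual σ ρ) ∧
    (∃ Φ : HypothesisSpace h ≃ₗᵢ[ℝ] StrongDual ℝ (PreDual σ ρ),
      ∀ (μ : RadonMeasure (Params L m)) (g : PreDual σ ρ),
        Φ (HypothesisSpace.ofMeasure h μ) g = μ.pairing g.toC0) := by
  let Φ : HypothesisSpace h ≃ₗᵢ[ℝ] StrongDual ℝ (PreDual σ ρ) :=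
    ⟨HypothesisSpace.equivDual h, HypothesisSpace.norm_equivDual h⟩
  refine ⟨?_, ⟨⟨HypothesisSpace.equivQuotient h, HypothesisSpace.norm_equivQuotient h⟩,
    HypothesisSpace.equivQuotient_ofMeasure h⟩, ?_, Φ, fun μ g => ?_⟩
  -- Completeness is transported from the dual space along the isometry.
  · exact (completeSpace_congr Φ.isometry.isUniformEmbedding (e := Φ.toEquiv)).2 inferInstance
  · exact (Submodule.isClosed_topologicalClosure _).completeSpace_coe
  · change HypothesisSpace.equivDual h (HypothesisSpace.ofMeasure h μ) g = _
    rw [HypothesisSpace.equivDual_ofMeasure]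
    rfl
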